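/- Let $\mathbb H_{\mathbb C}=\mathbb H\otimes\mathbb C$ be the complexified quaternions, identified with the complex $2\times2$ matrices $Z=(z_{ij})$, and put $N(Z)=\det Z$. Let $\mathrm{Zh}^+=\mathbb C[z_{11},z_{12},z_{21},z_{22}]$ be the space of polynomial functions on $\mathbb H_{\mathbb C}$, and let $\mathcal H^+=\{\phi\in \mathrm{Zh}^+ : \square\phi=0\}$, where $\square=4\left(\frac{\partial^2}{\partial z_{11}\partial z_{22}}-\frac{\partial^2}{\partial z_{12}\partial z_{21}}\right)$. For $h\in GL(2,\mathbb H_{\mathbb C})\simeq GL(4,\mathbb C)$ with blocks $h^{-1}=\begin{pmatrix}a&b\\c&d\end{pmatrix}$ and $h=\begin{pmatrix}a'&b'\\c'&d'\end{pmatrix}$, and for integers $m,n\ge0$, consider the action $$f(Z)\;\mapsto\;\frac{f\bigl((aZ+b)(cZ+d)^{-1}\bigr)}{N(cZ+d)^{m}\,N(a'-Zc')^{n}} .$$ Differentiating it gives an action of the Lie algebra $\mathfrak{gl}(2,\mathbb H_{\mathbb C})\simeq\mathfrak{gl}(4,\mathbb C)$ on $\mathrm{Zh}^+$. It is denoted by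 $\rho_1$ for $(m,n)=(1,1)$. For $(m,n)=(1,0)$ and $(0,1)$ it preserves $\mathcal H^+$, and its restriction to $\mathcal H^+$ is denoted by $\pi^0_l$ and $\pi^0_r$ respectively. There is exactly one $\mathfrak{gl}(2,\mathbb H_{\mathbb C})$-equivariant linear map $$I:(\rho_1,\mathrm{Zh}^+)\to(\pi^0_l,\mathcal H^+)\otimes(\pi^0_r,\mathcal H^+)\qquad\text{with } I(1)=1\otimes1 .$$ It is injective, and for every $p=1,2,3,\dots$ and every coordinate $z_{ij}\in\{z_{11},z_{12},z_{21},z_{22}\}$, $$\bigl(I (z_{ij})^p\bigr)(W,W')=\frac1{p+1}\sum_{k=0}^p (w_{ij})^k\,(w'_{ij})^{p-k},$$ where an element $\sum_r\phi_r\otimes\psi_r$ of $\mathcal H^+\otimes\mathcal H^+$ is written as the function $\sum_r\phi_r(W)\psi_r(W')$, and $w_{ij}$, $w'_{ij}$ are the entries of $W$, $W'$. -/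

import Mathlib

open scoped TensorProduct

noncomputable section

namespace LadderDiagram

/-- The complexified quaternions `ℍ ⊗ ℂ`, identified with the algebra of complex `2 × 2` matrices. -/
abbrev HC : Type := Matrix (Fin 2) (Fin 2) ℂ

/-- The complex Lie algebra `gl(2, ℍ_ℂ) ≃ gl(4, ℂ)`: block matrices `(A B; C D)` with blocks in
`ℍ_ℂ`. -/
abbrev GL2HC : Type := Matrix (Fin 2 ⊕ Fin 2) (Fin 2 ⊕ Fin 2) ℂ

/-- The space `Zh⁺ = ℂ[z₁₁, z₁₂, z₂₁, z₂₂]` of polynomial functions on `ℍ_ℂ`. The indices `1, 2`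
are `0, 1 : Fin 2` here. -/
abbrev ZhPlus : Type := MvPolynomial (Fin 2 × Fin 2) ℂ

/-- The coordinate function `z_{ij}`. -/
def coord (i j : Fin 2) : ZhPlus := MvPolynomial.X (i, j)

/-- The value of a polynomial function at `Z ∈ ℍ_ℂ`. -/
def evalAt (Z : HC) (f : ZhPlus) : ℂ := MvPolynomial.eval (fun ij => Z ij.1 ij.2) f

/-- The partial derivative `∂_{ij} = ∂/∂z_{ij}`. -/
def partialD (i j : Fin 2) : ZhPlus →ₗ[ℂ] ZhPlus :=
  (MvPolynomial.pderiv (i, j) : Derivation ℂ ZhPlus ZhPlus).toLinearMap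

/-- The Laplacian `□ = 4 (∂₁₁ ∂₂₂ - ∂₁₂ ∂₂₁)`. -/
def box : ZhPlus →ₗ[ℂ] ZhPlus :=
  (4 : ℂ) • (partialD 0 0 ∘ₗ partialD 1 1 - partialD 0 1 ∘ₗ partialD 1 0)

/-- The space `H⁺` of harmonic polynomials on `ℍ_ℂ`. -/
abbrev HPlus : Submodule ℂ ZhPlus := LinearMap.ker box

/-! ### Conformal actions -/

/-- The conformal action of `h ∈ GL(2, ℍ_ℂ)` on functions on `ℍ_ℂ` with weights `m, n`:
`f(Z) ↦ f((aZ+b)(cZ+d)⁻¹) / (N(cZ+d)^m N(a'-Zc')^n)`,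
where `h⁻¹ = (a b; c d)`, `h = (a' b'; c' d')` and `N = det`.
For `(m, n) = (1, 1), (1, 0), (0, 1)` these are the actions `ρ₁`, `π⁰_l`, `π⁰_r` respectively. -/
def groupAct (m n : ℕ) (h : GL2HC) (f : HC → ℂ) (Z : HC) : ℂ :=
  f ((h⁻¹.toBlocks₁₁ * Z + h⁻¹.toBlocks₁₂) * (h⁻¹.toBlocks₂₁ * Z + h⁻¹.toBlocks₂₂)⁻¹) /
    ((h⁻¹.toBlocks₂₁ * Z + h⁻¹.toBlocks₂₂).det ^ m *
      (h.toBlocks₁₁ - Z * h.toBlocks₂₁).det ^ n)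

/-- The generic point `Z = (z_{ij})` as a matrix of polynomials. -/
def genericZ : Matrix (Fin 2) (Fin 2) ZhPlus := Matrix.of coord

/-- A complex matrix as a matrix of constant polynomials. -/
def constM (A : HC) : Matrix (Fin 2) (Fin 2) ZhPlus := A.map MvPolynomial.C

/-- The infinitesimal fractional linear transformation: the vector field
`-AZ - B + ZCZ + ZD` on `ℍ_ℂ`. -/
def vecField (X : GL2HC) : Matrix (Fin 2) (Fin 2) ZhPlus :=
  -(constM X.toBlocks₁₁ * genericZ) - constM X.toBlocks₁₂ +
    genericZ * constM X.toBlocks₂₁ * genericZ + genericZ * constM X.toBlocks₂₂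

/-- The infinitesimal multiplier `m tr(CZ + D) + n tr(ZC - A)`. -/
def multiplier (m n : ℕ) (X : GL2HC) : ZhPlus :=
  (m : ZhPlus) * (constM X.toBlocks₂₁ * genericZ + constM X.toBlocks₂₂).trace +
    (n : ZhPlus) * (genericZ * constM X.toBlocks₂₁ - constM X.toBlocks₁₁).trace

/-- The differential of the conformal action with weights `m, n`: the action of the Lie algebra
`gl(2, ℍ_ℂ)` on polynomial functions (see `hasDerivAt_groupAct_exp`). -/
def lieAct (m n : ℕ) (X : GL2HC) : ZhPlus →ₗ[ℂ] ZhPlus :=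
  (∑ i : Fin 2, ∑ j : Fin 2, LinearMap.mulLeft ℂ (vecField X i j) ∘ₗ partialD i j) +
    LinearMap.mulLeft ℂ (multiplier m n X)

lemma hasDerivAt_evalAt (f : ZhPlus) (γ : ℂ → HC) (γ' : HC) (t : ℂ)
    (hγ : ∀ i j, HasDerivAt (fun s => γ s i j) (γ' i j) t) :
    HasDerivAt (fun s => evalAt (γ s) f)
      (∑ i, ∑ j, γ' i j * evalAt (γ t) (partialD i j f)) t := by
  induction f using MvPolynomial.induction_on with
  | C a => simpa [evalAt, partialD] using hasDerivAt_const t a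
  | add p q hp hq =>
    have := hp.add hq
    refine (this.congr_deriv ?_).congr_of_eventuallyEq (.of_forall fun s => ?_)
    · simp only [evalAt, map_add, Fin.sum_univ_two]; ring
    · simp [evalAt]
  | mul_X p ij hp =>
    obtain ⟨i, j⟩ := ij
    have := hp.mul (hγ i j)
    refine (this.congr_deriv ?_).congr_of_eventuallyEq (.of_forall fun s => ?_)
    · fin_cases i <;> fin_cases j <;>
      · simp [evalAt, partialD, Derivation.leibniz, MvPolynomial.pderiv_X, Fin.sum_univ_two,
          Pi.single_apply]
        ring
    · simp [evalAt]

section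
attribute [local instance] Matrix.linftyOpNormedRing Matrix.linftyOpNormedAlgebra
  Matrix.linftyOpNormedAddCommGroup

lemma hasDerivAt_exp_entry (X : GL2HC) (i j : Fin 2 ⊕ Fin 2) :
    HasDerivAt (fun t : ℂ => NormedSpace.exp (t • X) i j) (X i j) 0 := by
  have h := hasDerivAt_exp_smul_const (𝕂 := ℂ) X 0
  rw [zero_smul, NormedSpace.exp_zero, one_mul] at h
  have h2 := ((LinearMap.toContinuousLinearMap
    (Matrix.entryLinearMap ℂ ℂ i j)).hasFDerivAt.comp_hasDerivAt 0 h)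
  exact h2

end

lemma hasDerivAt_det_entry (Q : ℂ → HC) (Q' : HC)
    (hQ : ∀ i j, HasDerivAt (fun t => Q t i j) (Q' i j) 0) (hQ0 : Q 0 = 1) :
    HasDerivAt (fun t => (Q t).det) Q'.trace 0 := by
  have := ((hQ 0 0).mul (hQ 1 1)).sub ((hQ 0 1).mul (hQ 1 0))
  refine (this.congr_deriv ?_).congr_of_eventuallyEq (.of_forall fun t => ?_)
  · simp [hQ0, Matrix.trace]
  · simp [Matrix.det_fin_two]

lemma hasDerivAt_mul_inv_entry (P Q : ℂ → HC) (P' Q' : HC)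
    (hP : ∀ i j, HasDerivAt (fun t => P t i j) (P' i j) 0)
    (hQ : ∀ i j, HasDerivAt (fun t => Q t i j) (Q' i j) 0) (hQ0 : Q 0 = 1) (i j : Fin 2) :
    HasDerivAt (fun t => (P t * (Q t)⁻¹) i j) ((P' - P 0 * Q') i j) 0 := by
  have hd := (hasDerivAt_det_entry Q Q' hQ hQ0).inv (by simp [hQ0])
  fin_cases j
  · have := hd.mul (((hP i 0).mul (hQ 1 1)).sub ((hP i 1).mul (hQ 1 0)))
    refine (this.congr_deriv ?_).congr_of_eventuallyEq (.of_forall fun t => ?_)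
    · simp [hQ0, Matrix.trace, Matrix.mul_apply, Fin.sum_univ_two]; ring
    · simp [Matrix.inv_def, Matrix.adjugate_fin_two, Matrix.mul_apply, Fin.sum_univ_two]; ring
  · have := hd.mul (((hP i 1).mul (hQ 0 0)).sub ((hP i 0).mul (hQ 0 1)))
    refine (this.congr_deriv ?_).congr_of_eventuallyEq (.of_forall fun t => ?_)
    · simp [hQ0, Matrix.trace, Matrix.mul_apply, Fin.sum_univ_two]; ring
    · simp [Matrix.inv_def, Matrix.adjugate_fin_two, Matrix.mul_apply, Fin.sum_univ_two]; ring

/-- The operators `lieAct m n X` are the derivatives of the group action along the one-parameter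
subgroups of `GL(2, ℍ_ℂ)`. -/
theorem hasDerivAt_groupAct_exp (m n : ℕ) (X : GL2HC) (f : ZhPlus) (Z : HC) :
    HasDerivAt (fun t : ℂ => groupAct m n (NormedSpace.exp (t • X)) (fun W => evalAt W f) Z)
      (evalAt Z (lieAct m n X f)) 0 := by
  set p : ℂ → GL2HC := fun t => NormedSpace.exp (t • X) with hp
  set q : ℂ → GL2HC := fun t => NormedSpace.exp (t • (-X)) with hq
  have hpq : ∀ t, (p t)⁻¹ = q t := fun t => by
    simp only [hp, hq, smul_neg]; rw [Matrix.exp_neg]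
  have hp' : ∀ i j, HasDerivAt (fun t => p t i j) (X i j) 0 := hasDerivAt_exp_entry X
  have hq' : ∀ i j, HasDerivAt (fun t => q t i j) (-X i j) 0 := hasDerivAt_exp_entry (-X)
  have hp0 : p 0 = 1 := by simp [hp]
  have hq0 : q 0 = 1 := by simp [hq]
  clear_value p q
  have hnum : ∀ i j, HasDerivAt (fun t => ((q t).toBlocks₁₁ * Z + (q t).toBlocks₁₂) i j)
      ((-(X.toBlocks₁₁ * Z) - X.toBlocks₁₂) i j) 0 := fun i j => by
    have := (((hq' (.inl i) (.inl 0)).mul_const (Z 0 j)).add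
      ((hq' (.inl i) (.inl 1)).mul_const (Z 1 j))).add (hq' (.inl i) (.inr j))
    refine (this.congr_deriv ?_).congr_of_eventuallyEq (.of_forall fun t => ?_)
    · simp [Matrix.mul_apply, Matrix.toBlocks₁₁, Matrix.toBlocks₁₂]; ring
    · simp [Matrix.mul_apply, Matrix.toBlocks₁₁, Matrix.toBlocks₁₂]
  have hden : ∀ i j, HasDerivAt (fun t => ((q t).toBlocks₂₁ * Z + (q t).toBlocks₂₂) i j)
      ((-(X.toBlocks₂₁ * Z) - X.toBlocks₂₂) i j) 0 := fun i j => by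
    have := (((hq' (.inr i) (.inl 0)).mul_const (Z 0 j)).add
      ((hq' (.inr i) (.inl 1)).mul_const (Z 1 j))).add (hq' (.inr i) (.inr j))
    refine (this.congr_deriv ?_).congr_of_eventuallyEq (.of_forall fun t => ?_)
    · simp [Matrix.mul_apply, Matrix.toBlocks₂₁, Matrix.toBlocks₂₂]; ring
    · simp [Matrix.mul_apply, Matrix.toBlocks₂₁, Matrix.toBlocks₂₂]
  have hden' : ∀ i j, HasDerivAt (fun t => ((p t).toBlocks₁₁ - Z * (p t).toBlocks₂₁) i j)
      ((X.toBlocks₁₁ - Z * X.toBlocks₂₁) i j) 0 := fun i j => by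
    have := (hp' (.inl i) (.inl j)).sub (((hp' (.inr 0) (.inl j)).const_mul (Z i 0)).add
      ((hp' (.inr 1) (.inl j)).const_mul (Z i 1)))
    refine (this.congr_deriv ?_).congr_of_eventuallyEq (.of_forall fun t => ?_)
    · simp [Matrix.mul_apply, Matrix.toBlocks₁₁, Matrix.toBlocks₂₁]
    · simp [Matrix.mul_apply, Matrix.toBlocks₁₁, Matrix.toBlocks₂₁]
  have h11 : (1 : GL2HC).toBlocks₁₁ = 1 := by
    rw [← Matrix.fromBlocks_one, Matrix.toBlocks_fromBlocks₁₁]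
  have h12 : (1 : GL2HC).toBlocks₁₂ = 0 := by
    rw [← Matrix.fromBlocks_one, Matrix.toBlocks_fromBlocks₁₂]
  have h21 : (1 : GL2HC).toBlocks₂₁ = 0 := by
    rw [← Matrix.fromBlocks_one, Matrix.toBlocks_fromBlocks₂₁]
  have h22 : (1 : GL2HC).toBlocks₂₂ = 1 := by
    rw [← Matrix.fromBlocks_one, Matrix.toBlocks_fromBlocks₂₂]
  have hnum0 : (q 0).toBlocks₁₁ * Z + (q 0).toBlocks₁₂ = Z := by
    rw [hq0, h11, h12]; simp
  have hden0 : (q 0).toBlocks₂₁ * Z + (q 0).toBlocks₂₂ = 1 := by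
    rw [hq0, h21, h22]; simp
  have hden0' : (p 0).toBlocks₁₁ - Z * (p 0).toBlocks₂₁ = 1 := by
    rw [hp0, h11, h21]; simp
  have hγ := hasDerivAt_mul_inv_entry _ _ _ _ hnum hden hden0
  have hN := (hasDerivAt_evalAt f _ _ 0 hγ).mul
    ((((hasDerivAt_det_entry _ _ hden hden0).pow m).mul
      ((hasDerivAt_det_entry _ _ hden' hden0').pow n)).inv (by simp [hden0, hden0']))
  refine (hN.congr_deriv ?_).congr_of_eventuallyEq (.of_forall fun t => ?_)
  · simp only [hnum0, hden0, hden0', Pi.mul_apply, Pi.inv_apply, Pi.pow_apply, Matrix.det_one,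
      inv_one, mul_one, one_mul, one_pow, div_one]
    simp [lieAct, multiplier, vecField, genericZ, constM, coord, evalAt, Matrix.trace,
      Matrix.mul_apply, Fin.sum_univ_two]
    ring
  · have ht : NormedSpace.exp (t • X) = p t := by rw [hp]
    simp only [groupAct, ht, hpq, div_eq_mul_inv, Pi.mul_apply, Pi.inv_apply, Pi.pow_apply]

/-! ### The representations `(π⁰_l, H⁺)`, `(π⁰_r, H⁺)` -/

lemma partialD_comm (i j k l : Fin 2) (f : ZhPlus) :
    partialD i j (partialD k l f) = partialD k l (partialD i j f) := by
  have h : ⁅(MvPolynomial.pderiv (i, j) : Derivation ℂ ZhPlus ZhPlus),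
      (MvPolynomial.pderiv (k, l) : Derivation ℂ ZhPlus ZhPlus)⁆ = 0 := by
    refine MvPolynomial.derivation_ext fun x => ?_
    simp only [Derivation.commutator_apply, MvPolynomial.pderiv_X, Pi.single_apply,
      Derivation.coe_zero, Pi.zero_apply]
    split_ifs <;> simp
  have h2 := DFunLike.congr_fun h f
  rw [Derivation.commutator_apply] at h2
  exact sub_eq_zero.mp h2

lemma lieAct_mem_HPlus (m n : ℕ) (hmn : m + n = 1) (X : GL2HC) (f : ZhPlus) (hf : f ∈ HPlus) :
    lieAct m n X f ∈ HPlus := by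
  have c := partialD_comm
  have leib : ∀ (i j : Fin 2) (a b : ZhPlus),
      partialD i j (a * b) = a * partialD i j b + b * partialD i j a := fun i j a b => by
    simp [partialD, Derivation.leibniz]
  have hX : ∀ i j k l : Fin 2, partialD i j (MvPolynomial.X (k, l)) =
      if i = k ∧ j = l then 1 else 0 := fun i j k l => by
    simp [partialD, MvPolynomial.pderiv_X, Pi.single_apply, eq_comm]
  have hC : ∀ (i j : Fin 2) (a : ℂ), partialD i j (MvPolynomial.C a) = 0 := fun i j a => by
    simp [partialD]
  have h1 : ∀ i j : Fin 2, partialD i j 1 = 0 := fun i j => by simp [partialD]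
  have key : ∀ g : ZhPlus, g ∈ HPlus ↔
      partialD 0 0 (partialD 1 1 g) - partialD 0 1 (partialD 1 0 g) = 0 := fun g => by
    simp [box]
  rw [key] at hf ⊢
  have hf' : ∀ i j, partialD i j (partialD 0 0 (partialD 1 1 f)) -
      partialD i j (partialD 0 1 (partialD 1 0 f)) = 0 := fun i j => by
    rw [← map_sub, hf, map_zero]
  -- the Laplacian intertwines the weights `(m, n)` and `(m + 1, n + 1)`
  have hv : ∀ i j, vecField X i j * (partialD i j (partialD 0 0 (partialD 1 1 f)) -
      partialD i j (partialD 0 1 (partialD 1 0 f))) = 0 := fun i j => by rw [hf', mul_zero]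
  have hmul : multiplier (m + 1) (n + 1) X *
      (partialD 0 0 (partialD 1 1 f) - partialD 0 1 (partialD 1 0 f)) = 0 := by rw [hf, mul_zero]
  have f00 := hv 0 0
  have f01 := hv 0 1
  have f10 := hv 1 0
  have f11 := hv 1 1
  simp only [lieAct, LinearMap.add_apply, LinearMap.comp_apply, LinearMap.mulLeft_apply,
    LinearMap.sum_apply]
  simp only [multiplier, vecField, genericZ, constM, coord, Matrix.trace, Matrix.diag,
    Matrix.mul_apply, Fin.sum_univ_two, Matrix.add_apply, Matrix.sub_apply, Matrix.neg_apply,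
    Matrix.of_apply, Matrix.map_apply] at f00 f01 f10 f11 hmul ⊢
  obtain ⟨rfl, rfl⟩ | ⟨rfl, rfl⟩ : (m = 1 ∧ n = 0) ∨ (m = 0 ∧ n = 1) := by omega
  all_goals
    simp only [Nat.cast_one, Nat.cast_zero, one_mul, zero_mul, add_zero, zero_add, map_add, map_sub,
      map_neg, leib, hX, hC, map_zero, c 0 1 0 0, c 1 0 0 0, c 1 1 0 0, c 1 0 0 1, c 1 1 0 1,
      c 1 1 1 0] at f00 f01 f10 f11 hmul ⊢
    norm_num [h1]
    push_cast at hmul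
    linear_combination hmul + f00 + f01 + f10 + f11

/-- The action `ρ₁` of `gl(2, ℍ_ℂ)` on `Zh⁺`. -/
def rho1 (X : GL2HC) : ZhPlus →ₗ[ℂ] ZhPlus := lieAct 1 1 X

/-- The action `π⁰_l` of `gl(2, ℍ_ℂ)` on `H⁺`. -/
def piL (X : GL2HC) : HPlus →ₗ[ℂ] HPlus :=
  (lieAct 1 0 X).restrict (lieAct_mem_HPlus 1 0 rfl X)

/-- The action `π⁰_r` of `gl(2, ℍ_ℂ)` on `H⁺`. -/
def piR (X : GL2HC) : HPlus →ₗ[ℂ] HPlus :=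
  (lieAct 0 1 X).restrict (lieAct_mem_HPlus 0 1 rfl X)

/-- The action of `gl(2, ℍ_ℂ)` on `(π⁰_l, H⁺) ⊗ (π⁰_r, H⁺)`. -/
def tensorAct (X : GL2HC) : HPlus ⊗[ℂ] HPlus →ₗ[ℂ] HPlus ⊗[ℂ] HPlus :=
  (piL X).rTensor HPlus + (piR X).lTensor HPlus

lemma coord_pow_mem_HPlus (i j : Fin 2) (k : ℕ) : coord i j ^ k ∈ HPlus := by
  fin_cases i <;> fin_cases j <;>
    simp [box, partialD, coord, MvPolynomial.pderiv_X]

/-- The harmonic polynomial `(z_{ij})^k`. -/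
def coordPow (i j : Fin 2) (k : ℕ) : HPlus := ⟨coord i j ^ k, coord_pow_mem_HPlus i j k⟩

lemma one_mem_HPlus : (1 : ZhPlus) ∈ HPlus := by
  simpa using coord_pow_mem_HPlus 0 0 0

/-- The constant function `1` in `H⁺`. -/
def oneH : HPlus := ⟨1, one_mem_HPlus⟩

/-- `J : (ρ₁, Zh⁺) → (π⁰_l, H⁺) ⊗ (π⁰_r, H⁺)` is `gl(2, ℍ_ℂ)`-equivariant and `J(1) = 1 ⊗ 1`. -/
structure IsNormalizedEquivariant (J : ZhPlus →ₗ[ℂ] HPlus ⊗[ℂ] HPlus) : Prop where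
  equivariant : ∀ (X : GL2HC) (f : ZhPlus), J (rho1 X f) = tensorAct X (J f)
  map_one : J 1 = oneH ⊗ₜ[ℂ] oneH

end LadderDiagram

end

open LadderDiagram

/-!
Multiplication `φ ⊗ ψ ↦ φ ψ` (restriction to the diagonal `W = W'`) is a
`gl(2, ℍ_ℂ)`-equivariant map `π⁰_l ⊗ π⁰_r → ρ₁`, as the multipliers of the actions add up
(`lieAct_mul`, `mulH_tensorAct`). The map `I` is the inverse of its restriction to the submodule
`vacuumSubmodule` generated by `1 ⊗ 1`.

The restriction is surjective because `1` is a cyclic vector of `ρ₁`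
(`eq_top_of_one_mem_of_rho1_mem`). Indeed, if `K_{ij}` is the special conformal generator that
raises the degree in the direction of `z_{ij}`, then `∑ K_{ij} ∂_{ij} = E (E + 1) - 2 N Δ` in `ρ₁`,
where `E` is the Euler operator and `4 Δ = □`. By `[Δ, N] = E + 2` the eigenvalues of `N Δ` in
degree `d` are at most `d (d + 2) / 4 < d (d + 1) / 2`, so this operator is surjective in every
positive degree `d`, and every polynomial of degree `d` is obtained from polynomials of lower degree.

The restriction is injective by unitarity. The Fischer inner product `⟨z^α, z^α⟩ = α! / |α|!` is
contravariant for `π⁰_l` and `π⁰_r` on harmonic polynomials (`contraForm_lieAct`), hence so is its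
tensor square on `H⁺ ⊗ H⁺`. Since `⟨1 ⊗ 1, u⟩` is the constant term of the product of `u`, the
vector `1 ⊗ 1`, and with it the submodule it generates, is orthogonal to the kernel of
multiplication; a positive definite form leaves only `0` in their intersection.

Uniqueness of `I` follows again from cyclicity of `1`, and the values on `z_{ij}^p` by induction on
`p`, applying `K_{ij}` to both sides.
-/

open scoped TensorProduct

noncomputable section

namespace LadderDiagram

/-! ### The Lie algebra action in coordinates -/

lemma partialD_mul (i j : Fin 2) (f g : ZhPlus) :
    partialD i j (f * g) = f * partialD i j g + g * partialD i j f := by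
  simp [partialD, Derivation.leibniz]

lemma partialD_coord (i j k l : Fin 2) :
    partialD i j (coord k l) = if i = k ∧ j = l then 1 else 0 := by
  simp [partialD, coord, MvPolynomial.pderiv_X, Pi.single_apply, eq_comm]

lemma partialD_one (i j : Fin 2) : partialD i j 1 = 0 := by simp [partialD]

lemma lieAct_apply (m n : ℕ) (X : GL2HC) (f : ZhPlus) :
    lieAct m n X f =
      (∑ i, ∑ j, vecField X i j * partialD i j f) + multiplier m n X * f := by
  simp [lieAct]

/-- Pointwise multiplication intertwines `π⁰_l ⊗ π⁰_r` with `ρ₁`, since the multipliers add up. -/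
lemma lieAct_mul (X : GL2HC) (f g : ZhPlus) :
    lieAct 1 1 X (f * g) = lieAct 1 0 X f * g + f * lieAct 0 1 X g := by
  simp only [lieAct_apply, partialD_mul, Fin.sum_univ_two, multiplier]
  push_cast
  ring

/-- The generator of special conformal transformations that raises the degree by multiplication
with `z_{ij}`, up to terms with derivatives. -/
def raising (i j : Fin 2) : GL2HC := Matrix.fromBlocks 0 0 (Matrix.single j i 1) 0

lemma lieAct_raising (m n : ℕ) (i j : Fin 2) (f : ZhPlus) :
    lieAct m n (raising i j) f =
      (∑ k, ∑ l, coord k j * coord i l * partialD k l f) + ((m : ZhPlus) + n) * coord i j * f := by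
  fin_cases i <;> fin_cases j <;>
  · simp [lieAct_apply, vecField, multiplier, raising, constM, genericZ, Matrix.mul_apply,
      Matrix.trace, Matrix.single_apply, -mul_eq_mul_right_iff]
    ring

lemma lieAct_raising_coord_pow (m n : ℕ) (i j : Fin 2) (p : ℕ) :
    lieAct m n (raising i j) (coord i j ^ p) = ((p + m + n : ℕ) : ℂ) • coord i j ^ (p + 1) := by
  rw [lieAct_raising, MvPolynomial.smul_eq_C_mul]
  have h : ∀ k l, partialD k l (coord i j ^ p) =
      p * coord i j ^ (p - 1) * if k = i ∧ l = j then 1 else 0 := fun k l => by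
    rw [← partialD_coord]
    simp [partialD, mul_assoc]
  simp only [h]
  -- only the term with `k = i` and `l = j` survives
  have hs : (∑ k, ∑ l, coord k j * coord i l *
      (p * coord i j ^ (p - 1) * if k = i ∧ l = j then (1 : ZhPlus) else 0)) =
      p * coord i j ^ (p + 1) := by
    rcases p with _ | p
    · simp
    · fin_cases i <;> fin_cases j <;> simp [Fin.sum_univ_two] <;> ring
  rw [hs]
  simp only [map_natCast]
  push_cast
  ring

/-! ### The polynomials are generated by the constants -/

/-- The norm `N(Z) = det Z` as a polynomial. -/
def normZ : ZhPlus := coord 0 0 * coord 1 1 - coord 0 1 * coord 1 0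

/-- The Laplacian without its factor `4`. -/
def lap : ZhPlus →ₗ[ℂ] ZhPlus := partialD 0 0 ∘ₗ partialD 1 1 - partialD 0 1 ∘ₗ partialD 1 0

lemma lap_apply (f : ZhPlus) :
    lap f = partialD 0 0 (partialD 1 1 f) - partialD 0 1 (partialD 1 0 f) := rfl

lemma mem_HPlus_iff (f : ZhPlus) : f ∈ HPlus ↔ lap f = 0 := by
  simp [box, lap]

lemma euler_identity {d : ℕ} {f : ZhPlus} (hf : f.IsHomogeneous d) :
    ∑ i, ∑ j, coord i j * partialD i j f = (d : ZhPlus) * f := by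
  have := hf.sum_X_mul_pderiv
  rw [Fintype.sum_prod_type, nsmul_eq_mul] at this
  exact this

lemma euler_identity_partialD {d : ℕ} {f : ZhPlus} (hf : f.IsHomogeneous d) (i j : Fin 2) :
    ∑ k, ∑ l, coord k l * partialD k l (partialD i j f) = ((d : ZhPlus) - 1) * partialD i j f := by
  have h := congrArg (partialD i j) (euler_identity hf)
  have hd : partialD i j (d : ZhPlus) = 0 := by simp [partialD]
  have hs : partialD i j (∑ k, ∑ l, coord k l * partialD k l f) =
      (∑ k, ∑ l, coord k l * partialD k l (partialD i j f)) + partialD i j f := by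
    have hd' : ∀ k l, partialD i j (coord k l * partialD k l f) =
        coord k l * partialD k l (partialD i j f) +
          if i = k ∧ j = l then partialD i j f else 0 := fun k l => by
      rw [partialD_mul, partialD_comm i j k l, partialD_coord, mul_ite, mul_one, mul_zero]
      congr 1
      refine ite_congr rfl (fun h => ?_) fun _ => rfl
      rw [h.1, h.2]
    simp only [map_sum, hd', Finset.sum_add_distrib, ite_and]
    simp
  rw [hs, partialD_mul, hd] at h
  linear_combination h

lemma isHomogeneous_partialD {d : ℕ} {f : ZhPlus} (hf : f.IsHomogeneous d) (i j : Fin 2) :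
    (partialD i j f).IsHomogeneous (d - 1) := hf.pderiv

lemma isHomogeneous_normZ : normZ.IsHomogeneous 2 :=
  ((MvPolynomial.isHomogeneous_X ℂ _).mul (MvPolynomial.isHomogeneous_X ℂ _)).sub
    ((MvPolynomial.isHomogeneous_X ℂ _).mul (MvPolynomial.isHomogeneous_X ℂ _))

lemma isHomogeneous_lap {d : ℕ} {f : ZhPlus} (hf : f.IsHomogeneous (d + 2)) :
    (lap f).IsHomogeneous d :=
  (isHomogeneous_partialD (isHomogeneous_partialD hf 1 1) 0 0).sub
    (isHomogeneous_partialD (isHomogeneous_partialD hf 1 0) 0 1)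

lemma lap_eq_zero_of_isHomogeneous {d : ℕ} (hd : d ≤ 1) {f : ZhPlus} (hf : f.IsHomogeneous d) :
    lap f = 0 := by
  have key : ∀ g : ZhPlus, g.IsHomogeneous 0 → ∀ i j, partialD i j g = 0 := fun g hg i j => by
    rw [← MvPolynomial.totalDegree_zero_iff_isHomogeneous,
      MvPolynomial.totalDegree_eq_zero_iff_eq_C] at hg
    rw [hg]
    simp [partialD]
  have h : ∀ i j, (partialD i j f).IsHomogeneous 0 := fun i j => by
    have := isHomogeneous_partialD hf i j
    rwa [Nat.sub_eq_zero_of_le hd] at this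
  rw [lap_apply, key _ (h 1 1), key _ (h 1 0), sub_zero]

/-- The commutation relation `[Δ, N] = E + 2` on homogeneous polynomials of degree `d`. -/
lemma lap_normZ_mul {d : ℕ} {f : ZhPlus} (hf : f.IsHomogeneous d) :
    lap (normZ * f) = normZ * lap f + ((d : ZhPlus) + 2) * f := by
  have h := euler_identity hf
  simp only [Fin.sum_univ_two] at h
  simp only [lap_apply, normZ, sub_mul, mul_assoc, map_sub, map_add, partialD_mul, partialD_coord]
  norm_num [partialD_one]
  linear_combination h

/-- On homogeneous polynomials of degree `d` the eigenvalues of `N Δ` are the numbers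
`k (d - k + 1)` with `2 k ≤ d`, hence at most `d (d + 2) / 4`. For larger `c` the equation
`c g - N Δ g = f` is solved by recursion on the degree, as `Δ g` satisfies an equation
of the same kind with `c - d` in place of `c`. -/
lemma exists_smul_sub_normZ_mul_lap_eq (d : ℕ) : ∀ (c : ℝ), (d * (d + 2) / 4 : ℝ) < c →
    ∀ f : ZhPlus, f.IsHomogeneous d →
      ∃ g : ZhPlus, g.IsHomogeneous d ∧ (c : ℂ) • g - normZ * lap g = f := by
  induction d using Nat.twoStepInduction with
  | zero =>
    intro c hc f hf
    have hc0 : (c : ℂ) ≠ 0 := by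
      have : 0 < c := by simpa using hc
      exact_mod_cast this.ne'
    have hg : ((c : ℂ)⁻¹ • f).IsHomogeneous 0 :=
      (MvPolynomial.homogeneousSubmodule _ _ _).smul_mem _ hf
    exact ⟨(c : ℂ)⁻¹ • f, hg, by
      rw [lap_eq_zero_of_isHomogeneous zero_le_one hg, smul_inv_smul₀ hc0]; simp⟩
  | one =>
    intro c hc f hf
    have hc0 : (c : ℂ) ≠ 0 := by
      have : 0 < c := lt_trans (by norm_num) hc
      exact_mod_cast this.ne'
    have hg : ((c : ℂ)⁻¹ • f).IsHomogeneous 1 :=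
      (MvPolynomial.homogeneousSubmodule _ _ _).smul_mem _ hf
    exact ⟨(c : ℂ)⁻¹ • f, hg, by
      rw [lap_eq_zero_of_isHomogeneous le_rfl hg, smul_inv_smul₀ hc0]; simp⟩
  | more d ih _ =>
    intro c hc f hf
    have hc0 : (c : ℂ) ≠ 0 := by
      have : 0 < c := lt_of_le_of_lt (by positivity) hc
      exact_mod_cast this.ne'
    obtain ⟨q, hq, hqf⟩ := ih (c - (d + 2)) (by push_cast at hc; linarith) (lap f)
      (isHomogeneous_lap hf)
    have hNq : (normZ * q).IsHomogeneous (d + 2) := by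
      rw [add_comm]; exact isHomogeneous_normZ.mul hq
    refine ⟨(c : ℂ)⁻¹ • (f + normZ * q),
      (MvPolynomial.homogeneousSubmodule _ _ _).smul_mem _ (hf.add hNq), ?_⟩
    -- `q` is the value of `Δ g` for the solution `g = (f + N q) / c`
    have hlap : lap (f + normZ * q) = (c : ℂ) • q := by
      rw [map_add, lap_normZ_mul hq, ← hqf]
      simp only [MvPolynomial.smul_eq_C_mul]
      push_cast
      simp only [map_sub, map_add, map_natCast, map_ofNat]
      ring
    rw [smul_inv_smul₀ hc0, map_smul, hlap, inv_smul_smul₀ hc0, add_sub_cancel_right]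

/-- The operator `∑ K_{ij} ∂_{ij}`, the non-Cartan part of a Casimir element in `ρ₁`, is
`E (E + 1) - 2 N Δ`. -/
lemma sum_raising_partialD {d : ℕ} {f : ZhPlus} (hf : f.IsHomogeneous d) :
    ∑ i, ∑ j, lieAct 1 1 (raising i j) (partialD i j f) =
      ((d : ZhPlus) * (d + 1)) * f - 2 * (normZ * lap f) := by
  have h := euler_identity hf
  have h00 := congrArg (coord 0 0 * ·) (euler_identity_partialD hf 0 0)
  have h01 := congrArg (coord 0 1 * ·) (euler_identity_partialD hf 0 1)
  have h10 := congrArg (coord 1 0 * ·) (euler_identity_partialD hf 1 0)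
  have h11 := congrArg (coord 1 1 * ·) (euler_identity_partialD hf 1 1)
  simp only [lieAct_raising, Fin.sum_univ_two, lap_apply, normZ, partialD_comm 1 1 0 0,
    partialD_comm 1 0 0 1, partialD_comm 0 1 0 0, partialD_comm 1 0 0 0,
    partialD_comm 1 1 0 1, partialD_comm 1 1 1 0] at h00 h01 h10 h11 h ⊢
  push_cast
  linear_combination h00 + h01 + h10 + h11 + ((d : ZhPlus) + 1) * h

/-- `1` is a cyclic vector of `ρ₁`. -/
theorem eq_top_of_one_mem_of_rho1_mem (S : Submodule ℂ ZhPlus) (h1 : (1 : ZhPlus) ∈ S)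
    (hS : ∀ X, ∀ f ∈ S, rho1 X f ∈ S) : S = ⊤ := by
  have key : ∀ d : ℕ, ∀ f : ZhPlus, f.IsHomogeneous d → f ∈ S := by
    intro d
    induction d with
    | zero =>
      intro f hf
      rw [← MvPolynomial.totalDegree_zero_iff_isHomogeneous,
        MvPolynomial.totalDegree_eq_zero_iff_eq_C] at hf
      rw [hf, ← mul_one (MvPolynomial.C _), ← MvPolynomial.smul_eq_C_mul]
      exact S.smul_mem _ h1
    | succ d ih =>
      intro f hf
      -- `2 (c - N Δ) = E (E + 1) - 2 N Δ` for `c = d' (d' + 1) / 2` in degree `d' = d + 1`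
      obtain ⟨g, hg, hgf⟩ := exists_smul_sub_normZ_mul_lap_eq (d + 1)
        (((d : ℝ) + 1) * (d + 2) / 2) (by push_cast; nlinarith [Nat.cast_nonneg (α := ℝ) d]) f hf
      have hs := sum_raising_partialD hg
      have hf2 : f = (2 : ℂ)⁻¹ • ∑ i, ∑ j, lieAct 1 1 (raising i j) (partialD i j g) := by
        rw [eq_inv_smul_iff₀ two_ne_zero, hs, ← hgf]
        simp only [MvPolynomial.smul_eq_C_mul, mul_sub, ← mul_assoc]
        rw [← map_mul]
        push_cast
        rw [mul_div_cancel₀ _ two_ne_zero]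
        simp only [map_add, map_mul, map_natCast, map_one, map_ofNat]
        ring
      rw [hf2]
      exact S.smul_mem _ (S.sum_mem fun i _ => S.sum_mem fun j _ =>
        hS _ _ (ih _ (isHomogeneous_partialD hg i j)))
  rw [eq_top_iff]
  intro f _
  rw [← MvPolynomial.sum_homogeneousComponent f]
  exact S.sum_mem fun i _ => key i _ (MvPolynomial.homogeneousComponent_isHomogeneous i f)

/-! ### Weighted Fischer forms -/

open scoped ComplexConjugate Nat

/-- The Fischer form with weight `w`, the sesquilinear form for which the monomials `z^α` are
orthogonal with `⟨z^α, z^α⟩ = w(|α|) α!`. It is conjugate linear in the first variable. -/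
def fischer (w : ℕ → ℝ) (f : ZhPlus) : ZhPlus →ₗ[ℂ] ℂ :=
  (MvPolynomial.basisMonomials (Fin 2 × Fin 2) ℂ).constr ℂ fun α =>
    ((w α.degree * ∏ x, ((α x)! : ℝ) : ℝ) : ℂ) * conj (MvPolynomial.coeff α f)

lemma fischer_monomial (w : ℕ → ℝ) (f : ZhPlus) (α : Fin 2 × Fin 2 →₀ ℕ) :
    fischer w f (MvPolynomial.monomial α 1) =
      ((w α.degree * ∏ x, ((α x)! : ℝ) : ℝ) : ℂ) * conj (MvPolynomial.coeff α f) := by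
  rw [fischer, ← congrFun (MvPolynomial.coe_basisMonomials (Fin 2 × Fin 2) ℂ) α,
    Module.Basis.constr_basis]

lemma fischer_eq_sum (w : ℕ → ℝ) (f g : ZhPlus) {s : Finset (Fin 2 × Fin 2 →₀ ℕ)}
    (hs : g.support ⊆ s) :
    fischer w f g = ∑ α ∈ s, ((w α.degree * ∏ x, ((α x)! : ℝ) : ℝ) : ℂ) *
      conj (MvPolynomial.coeff α f) * MvPolynomial.coeff α g := by
  have hg : g = ∑ α ∈ s, MvPolynomial.coeff α g • MvPolynomial.monomial α (1 : ℂ) := by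
    conv_lhs => rw [g.as_sum]
    refine (Finset.sum_subset hs fun α _ hα => ?_).trans (Finset.sum_congr rfl fun α _ => ?_)
    · rw [MvPolynomial.notMem_support_iff.mp hα, MvPolynomial.monomial_zero]
    · rw [MvPolynomial.smul_monomial, smul_eq_mul, mul_one]
  conv_lhs => rw [hg]
  simp only [map_sum, map_smul, fischer_monomial, smul_eq_mul]
  exact Finset.sum_congr rfl fun α _ => mul_comm _ _

lemma fischer_conj_symm (w : ℕ → ℝ) (f g : ZhPlus) : conj (fischer w g f) = fischer w f g := by
  classical
  rw [fischer_eq_sum w g f Finset.subset_union_left,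
    fischer_eq_sum w f g (Finset.subset_union_right (s₁ := f.support)), map_sum]
  refine Finset.sum_congr rfl fun α _ => ?_
  simp only [map_mul, Complex.conj_ofReal, Complex.conj_conj]
  ring

lemma fischer_self (w : ℕ → ℝ) (f : ZhPlus) :
    fischer w f f = ((∑ α ∈ f.support, (w α.degree * ∏ x, ((α x)! : ℝ)) *
      ‖MvPolynomial.coeff α f‖ ^ 2 : ℝ) : ℂ) := by
  rw [fischer_eq_sum w f f subset_rfl, Complex.ofReal_sum]
  refine Finset.sum_congr rfl fun α _ => ?_
  rw [mul_assoc, Complex.conj_mul']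
  push_cast
  rfl

lemma fischer_add_left (w : ℕ → ℝ) (f g h : ZhPlus) :
    fischer w (f + g) h = fischer w f h + fischer w g h := by
  simp only [← fischer_conj_symm w _ h, map_add]

lemma fischer_smul_left (w : ℕ → ℝ) (c : ℂ) (f h : ZhPlus) :
    fischer w (c • f) h = conj c * fischer w f h := by
  simp only [← fischer_conj_symm w _ h, map_smul, smul_eq_mul, map_mul]

/-- Multiplication by a coordinate is adjoint to the partial derivative, at the cost of a shift of
the weight. -/
lemma fischer_coord_mul (w : ℕ → ℝ) (i j : Fin 2) (f g : ZhPlus) :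
    fischer w f (coord i j * g) = fischer (fun d => w (d + 1)) (partialD i j f) g := by
  suffices h : fischer w f ∘ₗ LinearMap.mulLeft ℂ (coord i j) =
      fischer (fun d => w (d + 1)) (partialD i j f) from LinearMap.congr_fun h g
  refine (MvPolynomial.basisMonomials (Fin 2 × Fin 2) ℂ).ext fun α => ?_
  have hX : coord i j * MvPolynomial.monomial α 1 =
      MvPolynomial.monomial (α + Finsupp.single (i, j) 1) (1 : ℂ) := by
    rw [coord, MvPolynomial.X, MvPolynomial.monomial_mul, add_comm, one_mul]
  have hfac : ∏ x, (((α + Finsupp.single (i, j) 1 : Fin 2 × Fin 2 →₀ ℕ) x)! : ℝ) =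
      (α (i, j) + 1) * ∏ x, ((α x)! : ℝ) := by
    rw [← Finset.mul_prod_erase _ _ (Finset.mem_univ (i, j)),
      ← Finset.mul_prod_erase Finset.univ (fun x => ((α x)! : ℝ)) (Finset.mem_univ (i, j)),
      ← mul_assoc]
    congr 1
    · simp [Nat.factorial_succ]
    · refine Finset.prod_congr rfl fun x hx => ?_
      rw [Finsupp.add_apply, Finsupp.single_eq_of_ne (Finset.ne_of_mem_erase hx), add_zero]
  rw [LinearMap.comp_apply, LinearMap.mulLeft_apply, MvPolynomial.coe_basisMonomials, hX,
    fischer_monomial, fischer_monomial, hfac, map_add, Finsupp.degree_single]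
  simp only [partialD, Derivation.coeFn_coe, MvPolynomial.coeff_pderiv]
  simp
  ring

lemma fischer_euler (w : ℕ → ℝ) (f g : ZhPlus) :
    fischer w f (∑ i, ∑ j, coord i j * partialD i j g) = fischer (fun d => d * w d) f g := by
  suffices h : fischer w f ∘ₗ (∑ i, ∑ j, LinearMap.mulLeft ℂ (coord i j) ∘ₗ partialD i j) =
      fischer (fun d => d * w d) f by
    simpa using LinearMap.congr_fun h g
  refine (MvPolynomial.basisMonomials (Fin 2 × Fin 2) ℂ).ext fun α => ?_
  have h := euler_identity (MvPolynomial.isHomogeneous_monomial (1 : ℂ) (d := α) rfl)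
  rw [LinearMap.comp_apply, MvPolynomial.coe_basisMonomials, fischer_monomial]
  simp only [LinearMap.sum_apply, LinearMap.comp_apply, LinearMap.mulLeft_apply]
  rw [h, ← nsmul_eq_mul, map_nsmul, fischer_monomial]
  simp
  ring

/-! ### The contravariant form on harmonic polynomials -/

/-- The Fischer form with weight `1 / d!` in degree `d`, for which `π⁰_l` and `π⁰_r` are
infinitesimally unitary with respect to the real form `u(2, 2)` of `gl(2, ℍ_ℂ)`. -/
def contraForm : ZhPlus → ZhPlus →ₗ[ℂ] ℂ := fischer fun d => ((d ! : ℝ))⁻¹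

lemma contraForm_coord_mul_partialD (i j k l : Fin 2) (f g : ZhPlus) :
    contraForm f (coord i j * partialD k l g) = contraForm (coord k l * partialD i j f) g := by
  rw [contraForm, fischer_coord_mul, ← fischer_conj_symm _ _ g, fischer_coord_mul,
    fischer_conj_symm]

lemma contraForm_euler_coord_mul (i j : Fin 2) (f g : ZhPlus) :
    contraForm f (∑ k, ∑ l, coord k l * partialD k l (coord i j * g)) =
      contraForm (partialD i j f) g := by
  rw [contraForm, fischer_euler, fischer_coord_mul]
  congr 2
  funext d
  have h1 : ((d : ℝ) + 1) ≠ 0 := by positivity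
  have h2 : (d ! : ℝ) ≠ 0 := by positivity
  push_cast [Nat.factorial_succ]
  field_simp

lemma contraForm_normZ_mul {f : ZhPlus} (hf : f ∈ HPlus) (g : ZhPlus) :
    contraForm f (normZ * g) = 0 := by
  have h : lap f = 0 := (mem_HPlus_iff f).mp hf
  rw [lap_apply, sub_eq_zero] at h
  rw [normZ, sub_mul, map_sub, mul_assoc, mul_assoc, contraForm]
  simp only [fischer_coord_mul]
  rw [partialD_comm 1 1 0 0, partialD_comm 1 0 0 1, h, sub_self]

/-- On harmonic polynomials the raising operators are adjoint to the partial derivatives: they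
differ from `f ↦ E (z_{ij} f)` by multiples of `N`, which are orthogonal to harmonic
polynomials. -/
lemma contraForm_lieAct_raising {m n : ℕ} (hmn : m + n = 1) (i j : Fin 2) {f : ZhPlus}
    (hf : f ∈ HPlus) (g : ZhPlus) :
    contraForm f (lieAct m n (raising i j) g) = contraForm (partialD i j f) g := by
  rw [← contraForm_euler_coord_mul, lieAct_raising, ← sub_eq_zero, ← map_sub]
  have hmn' : ((m : ZhPlus) + n) = 1 := by exact_mod_cast congrArg (Nat.cast (R := ZhPlus)) hmn
  -- for the opposite corner `(k, l)` the difference is `± N ∂_{kl} g`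
  have hq : ∃ q, (∑ k, ∑ l, coord k j * coord i l * partialD k l g) +
      ((m : ZhPlus) + n) * coord i j * g -
      ∑ k, ∑ l, coord k l * partialD k l (coord i j * g) = normZ * q := by
    rw [hmn']
    simp only [partialD_mul, partialD_coord, normZ, Fin.sum_univ_two]
    fin_cases i <;> fin_cases j
    · exact ⟨-partialD 1 1 g, by simp; ring⟩
    · exact ⟨partialD 1 0 g, by simp; ring⟩
    · exact ⟨partialD 0 1 g, by simp; ring⟩
    · exact ⟨-partialD 0 0 g, by simp; ring⟩
  obtain ⟨q, hq⟩ := hq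
  rw [hq, contraForm_normZ_mul hf]

lemma contraForm_conj_symm (f g : ZhPlus) : conj (contraForm g f) = contraForm f g :=
  fischer_conj_symm _ f g

lemma contraForm_add_left (f g h : ZhPlus) :
    contraForm (f + g) h = contraForm f h + contraForm g h := fischer_add_left _ f g h

lemma contraForm_smul_left (c : ℂ) (f h : ZhPlus) :
    contraForm (c • f) h = conj c * contraForm f h := fischer_smul_left _ c f h

lemma contraForm_one_left (f : ZhPlus) : contraForm 1 f = MvPolynomial.coeff 0 f := by
  rw [← contraForm_conj_symm, ← MvPolynomial.C_1, MvPolynomial.C_apply, contraForm,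
    fischer_monomial]
  simp

/-- `lieAct m n X` expanded in the entries of the blocks of `X`. -/
lemma lieAct_eq_sum (m n : ℕ) (X : GL2HC) (f : ZhPlus) :
    lieAct m n X f = (∑ i, ∑ j,
      (X.toBlocks₂₂ i j • ∑ k, coord k i * partialD k j f
        - X.toBlocks₁₁ i j • ∑ k, coord j k * partialD i k f
        - X.toBlocks₁₂ i j • partialD i j f
        + X.toBlocks₂₁ i j • lieAct m n (raising j i) f)) +
      ((m : ℂ) * X.toBlocks₂₂.trace - n * X.toBlocks₁₁.trace) • f := by
  simp only [lieAct_raising]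
  simp only [lieAct_apply, vecField, multiplier, constM, genericZ, Matrix.mul_apply, Matrix.trace,
    Matrix.diag, Matrix.map_apply, Matrix.of_apply, Fin.sum_univ_two, Matrix.add_apply,
    Matrix.sub_apply, Matrix.neg_apply, MvPolynomial.smul_eq_C_mul, map_add, map_sub, map_mul,
    map_natCast]
  ring

/-- The antilinear anti-involution of `gl(2, ℍ_ℂ)` with respect to which `contraForm` is
contravariant. The solutions of `X† = -X` form the real form `u(2, 2)`. -/
def dagger (X : GL2HC) : GL2HC :=
  Matrix.fromBlocks X.toBlocks₁₁.conjTranspose (-X.toBlocks₂₁.conjTranspose)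
    (-X.toBlocks₁₂.conjTranspose) X.toBlocks₂₂.conjTranspose

/-- `contraForm` is contravariant on harmonic polynomials. -/
lemma contraForm_lieAct {m n : ℕ} (hmn : m + n = 1) (X : GL2HC) {f g : ZhPlus}
    (hf : f ∈ HPlus) (hg : g ∈ HPlus) :
    contraForm f (lieAct m n X g) = contraForm (lieAct m n (dagger X) f) g := by
  have hr : ∀ i j, contraForm (lieAct m n (raising i j) f) g = contraForm f (partialD i j g) :=
    fun i j => by
      rw [← contraForm_conj_symm, contraForm_lieAct_raising hmn i j hg, contraForm_conj_symm]
  rw [lieAct_eq_sum m n X, lieAct_eq_sum m n (dagger X)]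
  simp only [dagger, Matrix.toBlocks_fromBlocks₁₁, Matrix.toBlocks_fromBlocks₁₂,
    Matrix.toBlocks_fromBlocks₂₁, Matrix.toBlocks_fromBlocks₂₂, Fin.sum_univ_two, Matrix.trace,
    Matrix.diag, sub_eq_add_neg, ← neg_smul, map_add, map_smul, contraForm_add_left,
    contraForm_smul_left, hr, contraForm_lieAct_raising hmn _ _ hf, contraForm_coord_mul_partialD,
    Matrix.conjTranspose_apply, Matrix.neg_apply, map_neg, map_mul, map_natCast, smul_eq_mul,
    RCLike.star_def, Complex.conj_conj]
  ring

/-- `contraForm` is an inner product. -/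
@[reducible] def contraFormCore : InnerProductSpace.Core ℂ ZhPlus where
  inner f g := contraForm f g
  conj_inner_symm := contraForm_conj_symm
  re_inner_nonneg f := by
    rw [contraForm, fischer_self, RCLike.re_eq_complex_re, Complex.ofReal_re]
    positivity
  add_left := contraForm_add_left
  smul_left f g c := contraForm_smul_left c f g
  definite f h := by
    rw [contraForm, fischer_self, Complex.ofReal_eq_zero,
      Finset.sum_eq_zero_iff_of_nonneg fun α _ => by positivity] at h
    refine MvPolynomial.ext _ _ fun α => ?_
    rw [MvPolynomial.coeff_zero]
    by_contra hα
    have h' := h α (MvPolynomial.mem_support_iff.mpr hα)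
    have hp : 0 < ((α.degree ! : ℝ))⁻¹ * ∏ x, ((α x)! : ℝ) := by positivity
    exact hα (norm_eq_zero.mp (pow_eq_zero_iff two_ne_zero |>.mp
      ((mul_eq_zero.mp h').resolve_left hp.ne')))

/-- A copy of `Zh⁺` carrying the inner product `contraForm`, so that Mathlib's inner product on
tensor products applies. -/
def FischerSpace : Type := ZhPlus

instance : NormedAddCommGroup FischerSpace := contraFormCore.toNormedAddCommGroup

instance : InnerProductSpace ℂ FischerSpace := InnerProductSpace.ofCore contraFormCore.toCore

/-- The inclusion of `H⁺` into the inner product space `FischerSpace`. -/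
def harmonicToFischer : HPlus →ₗ[ℂ] FischerSpace where
  toFun f := (f : ZhPlus)
  map_add' _ _ := rfl
  map_smul' _ _ := rfl

/-- The inclusion of `H⁺ ⊗ H⁺` into an inner product space. -/
def tensorToFischer : HPlus ⊗[ℂ] HPlus →ₗ[ℂ] FischerSpace ⊗[ℂ] FischerSpace :=
  TensorProduct.map harmonicToFischer harmonicToFischer

lemma tensorToFischer_injective : Function.Injective tensorToFischer :=
  TensorProduct.map_injective_of_flat_flat _ _ Subtype.val_injective Subtype.val_injective

/-- The tensor square of `contraForm`, an inner product on `H⁺ ⊗ H⁺`. -/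
def tensorForm (u v : HPlus ⊗[ℂ] HPlus) : ℂ := inner ℂ (tensorToFischer u) (tensorToFischer v)

lemma tensorForm_tmul (f₁ f₂ g₁ g₂ : HPlus) :
    tensorForm (f₁ ⊗ₜ[ℂ] f₂) (g₁ ⊗ₜ[ℂ] g₂) = contraForm f₁ g₁ * contraForm f₂ g₂ :=
  TensorProduct.inner_tmul (𝕜 := ℂ) (harmonicToFischer f₁) (harmonicToFischer g₁) (harmonicToFischer f₂)
    (harmonicToFischer g₂)

lemma tensorForm_add_left (u v w : HPlus ⊗[ℂ] HPlus) :
    tensorForm (u + v) w = tensorForm u w + tensorForm v w := by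
  rw [tensorForm, map_add]
  exact inner_add_left _ _ _

lemma tensorForm_add_right (u v w : HPlus ⊗[ℂ] HPlus) :
    tensorForm u (v + w) = tensorForm u v + tensorForm u w := by
  rw [tensorForm, map_add]
  exact inner_add_right _ _ _

lemma tensorForm_smul_right (c : ℂ) (u v : HPlus ⊗[ℂ] HPlus) :
    tensorForm u (c • v) = c * tensorForm u v := by
  rw [tensorForm, map_smul]
  exact inner_smul_right (tensorToFischer u) (tensorToFischer v) c

lemma tensorForm_zero_left (v : HPlus ⊗[ℂ] HPlus) : tensorForm 0 v = 0 := by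
  rw [tensorForm, map_zero]
  exact inner_zero_left _

lemma tensorForm_zero_right (u : HPlus ⊗[ℂ] HPlus) : tensorForm u 0 = 0 := by
  rw [tensorForm, map_zero]
  exact inner_zero_right _

lemma tensorForm_conj_symm (u v : HPlus ⊗[ℂ] HPlus) :
    conj (tensorForm v u) = tensorForm u v := 
  inner_conj_symm (tensorToFischer u) (tensorToFischer v)

lemma eq_zero_of_tensorForm_self {u : HPlus ⊗[ℂ] HPlus} (h : tensorForm u u = 0) : u = 0 :=
  tensorToFischer_injective ((inner_self_eq_zero (𝕜 := ℂ).mp h).trans (map_zero _).symm)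

/-- `tensorForm` is contravariant on `π⁰_l ⊗ π⁰_r`. -/
lemma tensorForm_tensorAct (X : GL2HC) (u v : HPlus ⊗[ℂ] HPlus) :
    tensorForm u (tensorAct X v) = tensorForm (tensorAct (dagger X) u) v := by
  induction u using TensorProduct.induction_on with
  | zero => simp only [map_zero, tensorForm_zero_left]
  | add u₁ u₂ h₁ h₂ => simp only [map_add, tensorForm_add_left, h₁, h₂]
  | tmul f₁ f₂ =>
    induction v using TensorProduct.induction_on with
    | zero => simp only [map_zero, tensorForm_zero_right]
    | add v₁ v₂ h₁ h₂ => simp only [map_add, tensorForm_add_right, h₁, h₂]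
    | tmul g₁ g₂ =>
      have hL : contraForm f₁ (piL X g₁) = contraForm (piL (dagger X) f₁) g₁ :=
        contraForm_lieAct rfl X f₁.2 g₁.2
      have hR : contraForm f₂ (piR X g₂) = contraForm (piR (dagger X) f₂) g₂ :=
        contraForm_lieAct rfl X f₂.2 g₂.2
      simp only [tensorAct, LinearMap.add_apply, LinearMap.rTensor_tmul, LinearMap.lTensor_tmul,
        tensorForm_add_left, tensorForm_add_right, tensorForm_tmul, hL, hR]

/-! ### Multiplication of harmonic polynomials -/

/-- The multiplication map `φ ⊗ ψ ↦ φ ψ`, that is, restriction to the diagonal `W = W'`. -/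
def mulH : HPlus ⊗[ℂ] HPlus →ₗ[ℂ] ZhPlus :=
  LinearMap.mul' ℂ ZhPlus ∘ₗ TensorProduct.map HPlus.subtype HPlus.subtype

lemma mulH_tmul (f g : HPlus) : mulH (f ⊗ₜ[ℂ] g) = (f : ZhPlus) * g := by simp [mulH]

lemma mulH_tensorAct (X : GL2HC) (u : HPlus ⊗[ℂ] HPlus) :
    mulH (tensorAct X u) = rho1 X (mulH u) := by
  induction u using TensorProduct.induction_on with
  | zero => simp
  | add u v hu hv => simp only [map_add, hu, hv]
  | tmul f g =>
    simp only [tensorAct, LinearMap.add_apply, LinearMap.rTensor_tmul, LinearMap.lTensor_tmul,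
      map_add, mulH_tmul, rho1, lieAct_mul]
    rfl

lemma tensorForm_oneH_tmul_oneH (u : HPlus ⊗[ℂ] HPlus) :
    tensorForm (oneH ⊗ₜ[ℂ] oneH) u = MvPolynomial.coeff 0 (mulH u) := by
  induction u using TensorProduct.induction_on with
  | zero => rw [tensorForm_zero_right, map_zero, MvPolynomial.coeff_zero]
  | add u v hu hv => rw [map_add, tensorForm_add_right, hu, hv, MvPolynomial.coeff_add]
  | tmul f g =>
    rw [tensorForm_tmul, mulH_tmul, oneH, contraForm_one_left, contraForm_one_left]
    simp only [← MvPolynomial.constantCoeff_eq, map_mul]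

/-! ### The submodule generated by `1 ⊗ 1` -/

/-- The `gl(2, ℍ_ℂ)`-submodule of `H⁺ ⊗ H⁺` generated by `1 ⊗ 1`. -/
def vacuumSubmodule : Submodule ℂ (HPlus ⊗[ℂ] HPlus) :=
  sInf {S | oneH ⊗ₜ[ℂ] oneH ∈ S ∧ ∀ X, ∀ u ∈ S, tensorAct X u ∈ S}

lemma one_mem_vacuumSubmodule : oneH ⊗ₜ[ℂ] oneH ∈ vacuumSubmodule :=
  Submodule.mem_sInf.mpr fun _ hS => hS.1

lemma tensorAct_mem_vacuumSubmodule (X : GL2HC) {u : HPlus ⊗[ℂ] HPlus}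
    (hu : u ∈ vacuumSubmodule) : tensorAct X u ∈ vacuumSubmodule :=
  Submodule.mem_sInf.mpr fun S hS => hS.2 X u (Submodule.mem_sInf.mp hu S hS)

/-- The vectors orthogonal to `ker mulH` form a submodule by contravariance, and `1 ⊗ 1` is one of
them since pairing with it extracts the constant term of the product. -/
lemma tensorForm_eq_zero_of_mem_vacuumSubmodule {u v : HPlus ⊗[ℂ] HPlus}
    (hu : u ∈ vacuumSubmodule) (hv : mulH v = 0) : tensorForm v u = 0 := by
  -- the vectors orthogonal to `ker mulH`
  let S : Submodule ℂ (HPlus ⊗[ℂ] HPlus) :=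
    { carrier := {u | ∀ v, mulH v = 0 → tensorForm v u = 0}
      zero_mem' := fun v _ => tensorForm_zero_right v
      add_mem' := fun {a b} ha hb v hv => by
        rw [tensorForm_add_right, ha v hv, hb v hv, add_zero]
      smul_mem' := fun c a ha v hv => by rw [tensorForm_smul_right, ha v hv, mul_zero] }
  refine Submodule.mem_sInf.mp hu S ⟨fun v hv => ?_, fun X u hu v hv => ?_⟩ v hv
  · rw [← tensorForm_conj_symm, tensorForm_oneH_tmul_oneH, hv, MvPolynomial.coeff_zero, map_zero]
  · rw [tensorForm_tensorAct]
    exact hu _ (by rw [mulH_tensorAct, hv, map_zero])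

/-- A difference of two elements with the same product lies both in the submodule and in its
orthogonal complement. -/
lemma injective_mulH_domRestrict :
    Function.Injective (mulH.domRestrict vacuumSubmodule) := by
  rintro ⟨u, hu⟩ ⟨v, hv⟩ huv
  have hd : mulH (u + (-1 : ℂ) • v) = 0 := by
    have h : mulH u = mulH v := huv
    rw [map_add, map_smul, h, neg_one_smul, add_neg_cancel]
  have h := eq_zero_of_tensorForm_self (tensorForm_eq_zero_of_mem_vacuumSubmodule
    (vacuumSubmodule.add_mem hu (vacuumSubmodule.smul_mem (-1 : ℂ) hv)) hd)
  have h' : (-1 : ℂ) • v + v = 0 :=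
    calc (-1 : ℂ) • v + v = ((-1 : ℂ) + 1) • v := by rw [add_smul, one_smul]
      _ = 0 := by rw [neg_add_cancel, zero_smul]
  have huv' : u = v := by rw [← add_zero u, ← h', ← add_assoc, h, zero_add]
  exact Subtype.ext huv'

/-- The image contains `1` and is invariant under `ρ₁`, for which `1` is cyclic. -/
lemma surjective_mulH_domRestrict :
    Function.Surjective (mulH.domRestrict vacuumSubmodule) := by
  rw [← LinearMap.range_eq_top]
  refine eq_top_of_one_mem_of_rho1_mem _ ⟨⟨_, one_mem_vacuumSubmodule⟩, ?_⟩ ?_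
  · simp [mulH_tmul, oneH]
  · rintro X _ ⟨u, rfl⟩
    exact ⟨⟨_, tensorAct_mem_vacuumSubmodule X u.2⟩, mulH_tensorAct X u⟩

/-- Multiplication identifies the submodule generated by `1 ⊗ 1` with `Zh⁺`. -/
def vacuumEquiv : vacuumSubmodule ≃ₗ[ℂ] ZhPlus :=
  LinearEquiv.ofBijective (mulH.domRestrict vacuumSubmodule)
    ⟨injective_mulH_domRestrict, surjective_mulH_domRestrict⟩

lemma isNormalizedEquivariant_vacuumEquiv_symm :
    IsNormalizedEquivariant (vacuumSubmodule.subtype ∘ₗ vacuumEquiv.symm.toLinearMap) where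
  equivariant X f := by
    obtain ⟨u, rfl⟩ := vacuumEquiv.surjective f
    have h : rho1 X (vacuumEquiv u) =
        vacuumEquiv ⟨_, tensorAct_mem_vacuumSubmodule X u.2⟩ := (mulH_tensorAct X u).symm
    rw [h]
    simp
  map_one := by
    have h : (1 : ZhPlus) = vacuumEquiv ⟨_, one_mem_vacuumSubmodule⟩ := by
      refine (Eq.symm ?_ : (1 : ZhPlus) = mulH (oneH ⊗ₜ[ℂ] oneH))
      simp [mulH_tmul, oneH]
    rw [h]
    simp

lemma IsNormalizedEquivariant.unique {I J : ZhPlus →ₗ[ℂ] HPlus ⊗[ℂ] HPlus}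
    (hI : IsNormalizedEquivariant I) (hJ : IsNormalizedEquivariant J) : J = I := by
  have h : LinearMap.eqLocus J I = ⊤ := by
    refine eq_top_of_one_mem_of_rho1_mem _ (hJ.map_one.trans hI.map_one.symm) fun X f hf => ?_
    rw [LinearMap.mem_eqLocus] at hf ⊢
    rw [hJ.equivariant, hI.equivariant, hf]
  exact LinearMap.eqLocus_eq_top.mp h

/-! ### Powers of the coordinates -/

lemma piL_raising_coordPow (i j : Fin 2) (k : ℕ) :
    piL (raising i j) (coordPow i j k) = ((k : ℂ) + 1) • coordPow i j (k + 1) := by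
  refine Subtype.ext ((lieAct_raising_coord_pow 1 0 i j k).trans ?_)
  push_cast
  rw [add_zero]
  rfl

lemma piR_raising_coordPow (i j : Fin 2) (k : ℕ) :
    piR (raising i j) (coordPow i j k) = ((k : ℂ) + 1) • coordPow i j (k + 1) := by
  refine Subtype.ext ((lieAct_raising_coord_pow 0 1 i j k).trans ?_)
  push_cast
  rw [add_zero]
  rfl

lemma tensorAct_raising_sum (i j : Fin 2) (p : ℕ) :
    tensorAct (raising i j)
        (∑ k ∈ Finset.range (p + 1), coordPow i j k ⊗ₜ[ℂ] coordPow i j (p - k)) =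
      ((p : ℂ) + 1) •
        ∑ k ∈ Finset.range (p + 2), coordPow i j k ⊗ₜ[ℂ] coordPow i j (p + 1 - k) := by
  have h : ∀ k ∈ Finset.range (p + 1),
      tensorAct (raising i j) (coordPow i j k ⊗ₜ[ℂ] coordPow i j (p - k)) =
        ((k + 1 : ℕ) : ℂ) • coordPow i j (k + 1) ⊗ₜ[ℂ] coordPow i j (p + 1 - (k + 1)) +
          ((p + 1 - k : ℕ) : ℂ) • coordPow i j k ⊗ₜ[ℂ] coordPow i j (p + 1 - k) := by
    intro k hk
    have hk' : p + 1 - k = p - k + 1 := by have := Finset.mem_range.mp hk; omega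
    rw [tensorAct, LinearMap.add_apply, LinearMap.rTensor_tmul, LinearMap.lTensor_tmul,
      piL_raising_coordPow, piR_raising_coordPow, hk', Nat.add_sub_add_right,
      TensorProduct.tmul_smul, TensorProduct.smul_tmul']
    push_cast
    rfl
  rw [map_sum, Finset.sum_congr rfl h, Finset.sum_add_distrib]
  have h0 := Finset.sum_range_succ'
    (fun k => (k : ℂ) • coordPow i j k ⊗ₜ[ℂ] coordPow i j (p + 1 - k)) (p + 1)
  have h1 := Finset.sum_range_succ
    (fun k => ((p + 1 - k : ℕ) : ℂ) • coordPow i j k ⊗ₜ[ℂ] coordPow i j (p + 1 - k)) (p + 1)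
  simp only [Nat.cast_zero, zero_smul, add_zero, Nat.sub_self] at h0 h1
  rw [← h0, ← h1, ← Finset.sum_add_distrib, Finset.smul_sum]
  refine Finset.sum_congr rfl fun k hk => ?_
  rw [← add_smul, ← Nat.cast_add,
    Nat.add_sub_cancel' (Nat.lt_succ_iff.mp (Finset.mem_range.mp hk))]
  push_cast
  rfl

lemma IsNormalizedEquivariant.map_coord_pow {I : ZhPlus →ₗ[ℂ] HPlus ⊗[ℂ] HPlus}
    (hI : IsNormalizedEquivariant I) (i j : Fin 2) (p : ℕ) :
    I (coord i j ^ p) = (1 / ((p : ℂ) + 1)) •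
      ∑ k ∈ Finset.range (p + 1), coordPow i j k ⊗ₜ[ℂ] coordPow i j (p - k) := by
  induction p with
  | zero =>
    have h : coordPow i j 0 = oneH := Subtype.ext (pow_zero _)
    simp [hI.map_one, h]
  | succ p ih =>
    have h1 : ((p : ℂ) + 1) ≠ 0 := Nat.cast_add_one_ne_zero p
    have h2 : ((p : ℂ) + 1 + 1) ≠ 0 := by exact_mod_cast Nat.cast_add_one_ne_zero (R := ℂ) (p + 1)
    have h := hI.equivariant (raising i j) (coord i j ^ p)
    rw [rho1, lieAct_raising_coord_pow, map_smul, ih, map_smul, tensorAct_raising_sum, smul_smul,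
      one_div_mul_cancel h1, one_smul] at h
    rw [← h, smul_smul]
    push_cast
    rw [one_div_mul_cancel h2, one_smul]

end LadderDiagram

end

open LadderDiagram
theorem lemma10 :
    ∃ I : ZhPlus →ₗ[ℂ] HPlus ⊗[ℂ] HPlus,
      IsNormalizedEquivariant I ∧
      (∀ J : ZhPlus →ₗ[ℂ] HPlus ⊗[ℂ] HPlus, IsNormalizedEquivariant J → J = I) ∧
      Function.Injective I ∧
      ∀ p : ℕ, 1 ≤ p → ∀ i j : Fin 2,
        I (coord i j ^ p) =
          (1 / ((p : ℂ) + 1)) •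
            ∑ k ∈ Finset.range (p + 1), coordPow i j k ⊗ₜ[ℂ] coordPow i j (p - k) :=
  ⟨_, isNormalizedEquivariant_vacuumEquiv_symm,
    fun _ hJ => isNormalizedEquivariant_vacuumEquiv_symm.unique hJ,
    Subtype.val_injective.comp vacuumEquiv.symm.injective,
    fun p _ i j => isNormalizedEquivariant_vacuumEquiv_symm.map_coord_pow i j p⟩
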